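/- For a set $A$, let $A^\circ$ be the set of isomorphism classes of countable linear orders with positions labelled by elements of $A$ (the $\circ$-words over $A$); fix either of the two conventions that the empty word is, or is not, a $\circ$-word. Free multiplication $(A^\circ)^\circ \to A^\circ$ replaces each position of a $\circ$-word of $\circ$-words by the $\circ$-word in its label (lexicographic sum). A $\circ$-semigroup is a set $S$ with a map $\mu : S^\circ \to S$ that sends each one-letter word to its letter and satisfies $\mu(\mathrm{flat}(w)) = \mu(\mu^\circ(w))$ for all $w \in (S^\circ)^\circ$, where $\mathrm{flat}$ is free multiplication and $\mu^\circ$ applies $\mu$ to every label. The shuffle of a finite set $B \subseteq S$ is the unique $\circ$-word with labels in $B$ that has no first and no last position and in which every $b \in B$ occurs, and occurs between any two distinct positions; $B$ is required to be nonempty unless the empty word is admitted, in which case the shuffle of $\emptyset$ is the empty word. The Läuchli–Leonard operations of $(S,\mu)$ are $$ab=\mu(ab),\qquad a^\omega=\mu(aaa\cdots),\qquad a^{\omega*}=\mu(\cdots aaa),\qquad B^\eta=\mu(\text{shuffle of }B).$$ **Theorem.** Let $S$ be a finite set. 1. If $\mu_1,\mu_2 : S^\circ\to S$ are two $\circ$-semigroup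 multiplications on $S$ with the same Läuchli–Leonard operations, then $\mu_1=\mu_2$. In other words, the multiplication of a finite $\circ$-semigroup is uniquely determined by its Läuchli–Leonard operations. 2. If $(S,\mu)$ is a $\circ$-semigroup and $\Sigma\subseteq S$, then the sub-algebra $\{\mu(w) : w\in\Sigma^\circ\}$ generated by $\Sigma$ is the smallest subset of $S$ that contains $\Sigma$ and is closed under the Läuchli–Leonard operations. -/

import Mathlib

universe u v

/-- A countable linear order with positions labelled by elements of `A`. Every countable linear
order is isomorphic to one whose positions form a type in the lowest universe. The parameter
`emptyAllowed` says whether the empty order is admitted. -/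
structure LabelledOrder (emptyAllowed : Prop) (A : Type u) : Type (max 1 u) where
  Pos : Type
  [linearOrder : LinearOrder Pos]
  [countable : Countable Pos]
  nonempty : emptyAllowed ∨ Nonempty Pos
  label : Pos → A

attribute [instance] LabelledOrder.linearOrder LabelledOrder.countable

namespace LabelledOrder

variable {emptyAllowed : Prop} {A : Type u} {B : Type v}

/-- Isomorphism: a bijection between the positions that preserves order and labels. -/
def IsIso (X Y : LabelledOrder emptyAllowed A) : Prop :=
  ∃ e : X.Pos ≃o Y.Pos, ∀ x, Y.label (e x) = X.label x

instance setoid (emptyAllowed : Prop) (A : Type u) : Setoid (LabelledOrder emptyAllowed A) where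
  r := IsIso
  iseqv :=
    { refl := fun X => ⟨OrderIso.refl _, fun _ => rfl⟩
      symm := by
        rintro X Y ⟨e, he⟩
        exact ⟨e.symm, fun y => by rw [← he, e.apply_symm_apply]⟩
      trans := by
        rintro X Y Z ⟨e, he⟩ ⟨f, hf⟩
        exact ⟨e.trans f, fun x => by rw [OrderIso.trans_apply, hf, he]⟩ }

/-- Relabelling along a function. -/
def map (f : A → B) (X : LabelledOrder emptyAllowed A) : LabelledOrder emptyAllowed B where
  Pos := X.Pos
  nonempty := X.nonempty
  label := fun x => f (X.label x)

/-- The lexicographic sum: position `i` of `X` is replaced by the labelled order `Y i`. -/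
def lexSum {C : Type v} (X : LabelledOrder emptyAllowed C)
    (Y : X.Pos → LabelledOrder emptyAllowed A) : LabelledOrder emptyAllowed A where
  Pos := Σₗ i : X.Pos, (Y i).Pos
  countable := inferInstanceAs (Countable (Σ i : X.Pos, (Y i).Pos))
  nonempty := by
    rcases X.nonempty with h | ⟨⟨i⟩⟩
    · exact Or.inl h
    · rcases (Y i).nonempty with h | ⟨⟨j⟩⟩
      · exact Or.inl h
      · exact Or.inr ⟨toLex ⟨i, j⟩⟩
  label := fun p => (Y (ofLex p).1).label (ofLex p).2

theorem lexSum_congr {C : Type v} {X X' : LabelledOrder emptyAllowed C}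
    {Y : X.Pos → LabelledOrder emptyAllowed A} {Y' : X'.Pos → LabelledOrder emptyAllowed A}
    (e : X.Pos ≃o X'.Pos) (h : ∀ i, Y i ≈ Y' (e i)) : X.lexSum Y ≈ X'.lexSum Y' := by
  choose f hf using h
  let E : (Σ i, (Y i).Pos) ≃ (Σ i, (Y' i).Pos) :=
    Equiv.sigmaCongr e.toEquiv (fun i => (f i).toEquiv)
  refine ⟨⟨(ofLex.trans E).trans toLex, ?_⟩, ?_⟩
  · rintro ⟨i, x⟩ ⟨j, y⟩
    change toLex (⟨e i, f i x⟩ : Σ i, (Y' i).Pos) ≤ toLex ⟨e j, f j y⟩ ↔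
      toLex (⟨i, x⟩ : Σ i, (Y i).Pos) ≤ toLex ⟨j, y⟩
    constructor
    · intro h
      rcases Sigma.Lex.le_def.1 h with h | ⟨h, h'⟩
      · exact Sigma.Lex.le_def.2 (Or.inl (e.lt_iff_lt.1 h))
      · have hij : i = j := e.injective h
        subst hij
        exact Sigma.Lex.le_def.2 (Or.inr ⟨rfl, (f i).le_iff_le.1 h'⟩)
    · intro h
      rcases Sigma.Lex.le_def.1 h with h | ⟨h, h'⟩
      · exact Sigma.Lex.le_def.2 (Or.inl (e.lt_iff_lt.2 h))
      · have hij : i = j := h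
        subst hij
        exact Sigma.Lex.le_def.2 (Or.inr ⟨rfl, (f i).le_iff_le.2 h'⟩)
  · rintro ⟨i, x⟩
    exact hf i x

/-- `X` is a shuffle of the set `B` of letters: it uses only letters from `B`, it has no first and
no last position, and every letter of `B` occurs and occurs densely. -/
def IsShuffle (X : LabelledOrder emptyAllowed A) (B : Set A) : Prop :=
  (∀ x, X.label x ∈ B) ∧ (∀ x : X.Pos, ∃ y, y < x) ∧ (∀ x : X.Pos, ∃ y, x < y) ∧
    ∀ b ∈ B, (∃ x, X.label x = b) ∧ ∀ x y : X.Pos, x < y → ∃ z, x < z ∧ z < y ∧ X.label z = b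

theorem exists_rat_between (n : ℕ) {x y : ℚ} (h : x < y) :
    ∃ z, x < z ∧ z < y ∧ (padicValRat 2 z).toNat = n := by
  obtain ⟨k, hk⟩ := exists_nat_gt (3 * 2 ^ n / (y - x))
  have hd : 0 < y - x := sub_pos.2 h
  set b : ℚ := 2 * (k : ℚ) + 1 with hb
  have hk0 : (0 : ℚ) ≤ k := Nat.cast_nonneg k
  have hb0 : 0 < b := by positivity
  have h2 : (0 : ℚ) < 2 ^ n := by positivity
  have hlen : x * b / 2 ^ n + 3 < y * b / 2 ^ n := by
    rw [div_lt_iff₀ hd] at hk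
    rw [← sub_pos, show y * b / 2 ^ n - (x * b / 2 ^ n + 3)
      = ((y - x) * b - 3 * 2 ^ n) / 2 ^ n by field_simp; ring]
    apply div_pos _ h2
    nlinarith
  obtain ⟨a, ha1, ha2, ha⟩ : ∃ a : ℤ, x * b / 2 ^ n < a ∧ (a : ℚ) < y * b / 2 ^ n ∧ Odd a := by
    have h1 := Int.lt_floor_add_one (x * b / 2 ^ n)
    have h3 := Int.floor_le (x * b / 2 ^ n)
    rcases Int.even_or_odd ⌊x * b / 2 ^ n⌋ with he | ho
    · exact ⟨⌊x * b / 2 ^ n⌋ + 1, by push_cast; linarith, by push_cast; linarith, he.add_one⟩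
    · exact ⟨⌊x * b / 2 ^ n⌋ + 1 + 1, by push_cast; linarith, by push_cast; linarith,
        ho.add_one.add_one⟩
  have hb' : b = (((2 * k + 1 : ℕ) : ℤ) : ℚ) := by rw [hb]; push_cast; ring
  have ha0 : (a : ℚ) ≠ 0 := by
    rintro h0
    rw [Int.cast_eq_zero] at h0
    subst h0
    simp at ha
  refine ⟨2 ^ n * (a / b), ?_, ?_, ?_⟩
  · rw [div_lt_iff₀ h2] at ha1
    rw [← mul_div_assoc, lt_div_iff₀ hb0]
    linarith
  · rw [lt_div_iff₀ h2] at ha2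
    rw [← mul_div_assoc, div_lt_iff₀ hb0]
    linarith
  · have : Fact (Nat.Prime 2) := ⟨Nat.prime_two⟩
    have hva : padicValRat 2 (a : ℚ) = 0 := by
      rw [padicValRat.of_int, padicValInt.eq_zero_of_not_dvd, Nat.cast_zero]
      have := Int.odd_iff.1 ha
      omega
    have hvb : padicValRat 2 b = 0 := by
      rw [hb', padicValRat.of_int, padicValInt.eq_zero_of_not_dvd, Nat.cast_zero]
      omega
    have hv2 : padicValRat 2 ((2 : ℚ) ^ n) = n := by
      have h1 : padicValRat 2 (2 : ℚ) = 1 := padicValRat.self (p := 2) one_lt_two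
      rw [padicValRat.pow, h1, mul_one]
    rw [padicValRat.mul h2.ne' (div_ne_zero ha0 hb0.ne'), padicValRat.div ha0 hb0.ne',
      hva, hvb, hv2]
    simp

theorem exists_isShuffle {B : Set A} (hc : B.Countable) (hB : emptyAllowed ∨ B.Nonempty) :
    ∃ X : LabelledOrder emptyAllowed A, X.IsShuffle B := by
  rcases B.eq_empty_or_nonempty with rfl | hne
  · have h : emptyAllowed := hB.resolve_right (by simp)
    exact ⟨{ Pos := Empty, nonempty := Or.inl h, label := Empty.elim },
      fun x => x.elim, fun x => x.elim, fun x => x.elim, fun b hb => hb.elim⟩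
  · obtain ⟨e, he⟩ := hc.exists_eq_range hne
    refine ⟨{ Pos := ℚ, nonempty := Or.inr ⟨0⟩,
              label := fun q => e (padicValRat 2 q).toNat }, ?_, ?_, ?_, ?_⟩
    · intro x
      rw [he]
      exact ⟨_, rfl⟩
    · exact fun x => exists_lt x
    · exact fun x => exists_gt x
    · intro b hb
      rw [he] at hb
      obtain ⟨n, rfl⟩ := hb
      constructor
      · obtain ⟨z, -, -, hz⟩ := exists_rat_between n (zero_lt_one (α := ℚ))
        exact ⟨z, congrArg e hz⟩
      · intro x y hxy
        obtain ⟨z, h1, h2, hz⟩ := exists_rat_between n (x := x) (y := y) hxy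
        exact ⟨z, h1, h2, congrArg e hz⟩

/-- The extension step of the back-and-forth argument. -/
theorem IsShuffle.exists_across {X Y : LabelledOrder emptyAllowed A} {B : Set A}
    (hX : X.IsShuffle B) (hY : Y.IsShuffle B) (f : Finset (X.Pos × Y.Pos))
    (hf : ∀ p ∈ f, ∀ q ∈ f, cmp p.1 q.1 = cmp p.2 q.2)
    (hl : ∀ p ∈ f, X.label p.1 = Y.label p.2) (x : X.Pos) :
    ∃ y, X.label x = Y.label y ∧ ∀ p ∈ f, cmp p.1 x = cmp p.2 y := by
  classical
  by_cases h : ∃ y, (x, y) ∈ f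
  · obtain ⟨y, hy⟩ := h
    exact ⟨y, hl _ hy, fun p hp => hf _ hp _ hy⟩
  obtain ⟨hY1, hY2, hY3, hY4⟩ := hY
  obtain ⟨⟨y₀, -⟩, hd⟩ := hY4 _ (hX.1 x)
  have : Nonempty Y.Pos := ⟨y₀⟩
  have : NoMinOrder Y.Pos := ⟨hY2⟩
  have : NoMaxOrder Y.Pos := ⟨hY3⟩
  have : DenselyOrdered Y.Pos :=
    ⟨fun a b hab => let ⟨z, h1, h2, _⟩ := hd a b hab; ⟨z, h1, h2⟩⟩
  set lo := (f.filter fun p => p.1 < x).image Prod.snd with hlo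
  set hi := (f.filter fun p => x < p.1).image Prod.snd with hhi
  have key : ∀ a ∈ lo, ∀ b ∈ hi, a < b := by
    intro a ha b hb
    rw [hlo, Finset.mem_image] at ha
    rw [hhi, Finset.mem_image] at hb
    obtain ⟨p, hp, rfl⟩ := ha
    obtain ⟨q, hq, rfl⟩ := hb
    rw [Finset.mem_filter] at hp hq
    rw [← lt_iff_lt_of_cmp_eq_cmp (hf _ hp.1 _ hq.1)]
    exact hp.2.trans hq.2
  obtain ⟨m, hm1, hm2⟩ := Order.exists_between_finsets _ _ key
  obtain ⟨m', hm1', hm2'⟩ := Order.exists_between_finsets (insert m lo) hi (by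
    intro a ha b hb
    rcases Finset.mem_insert.1 ha with rfl | ha
    · exact hm2 b hb
    · exact key a ha b hb)
  obtain ⟨z, hz1, hz2, hz⟩ := hd m m' (hm1' m (Finset.mem_insert_self _ _))
  refine ⟨z, hz.symm, ?_⟩
  rintro ⟨p1, p2⟩ hp
  have hne : p1 ≠ x := fun he => h ⟨p2, he ▸ hp⟩
  rcases lt_or_gt_of_ne hne with hlt | hgt
  · have h2 : p2 < z := (hm1 _ (Finset.mem_image.2
      ⟨(p1, p2), Finset.mem_filter.2 ⟨hp, hlt⟩, rfl⟩)).trans hz1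
    exact ((cmp_eq_lt_iff _ _).2 hlt).trans ((cmp_eq_lt_iff _ _).2 h2).symm
  · have h2 : z < p2 := hz2.trans (hm2' _ (Finset.mem_image.2
      ⟨(p1, p2), Finset.mem_filter.2 ⟨hp, hgt⟩, rfl⟩))
    exact ((cmp_eq_gt_iff _ _).2 hgt).trans ((cmp_eq_gt_iff _ _).2 h2).symm

theorem IsShuffle.isIso {X Y : LabelledOrder emptyAllowed A} {B : Set A}
    (hX : X.IsShuffle B) (hY : Y.IsShuffle B) : X.IsIso Y := by
  classical
  cases nonempty_encodable X.Pos
  cases nonempty_encodable Y.Pos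
  let P : Finset (X.Pos × Y.Pos) → Prop := fun f =>
    (∀ p ∈ f, ∀ q ∈ f, cmp p.1 q.1 = cmp p.2 q.2) ∧ ∀ p ∈ f, X.label p.1 = Y.label p.2
  have insertP : ∀ (f : Finset (X.Pos × Y.Pos)) (x y), P f → X.label x = Y.label y →
      (∀ p ∈ f, cmp p.1 x = cmp p.2 y) → P (insert (x, y) f) := by
    intro f x y hf hxy h
    constructor
    · intro p hp q hq
      rw [Finset.mem_insert] at hp hq
      rcases hp with rfl | hp <;> rcases hq with rfl | hq
      · simp
      · rw [cmp_eq_cmp_symm]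
        exact h _ hq
      · exact h _ hp
      · exact hf.1 _ hp _ hq
    · intro p hp
      rcases Finset.mem_insert.1 hp with rfl | hp
      · exact hxy
      · exact hf.2 _ hp
  have across : ∀ f : Subtype P, ∀ y : Y.Pos, ∃ x, X.label x = Y.label y ∧
      ∀ p ∈ f.1, cmp p.1 x = cmp p.2 y := by
    rintro ⟨f, hf⟩ y
    obtain ⟨x, hx, h⟩ := hY.exists_across hX (f.image Prod.swap)
      (by
        intro p hp q hq
        obtain ⟨p, hp', rfl⟩ := Finset.mem_image.1 hp
        obtain ⟨q, hq', rfl⟩ := Finset.mem_image.1 hq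
        exact (hf.1 _ hp' _ hq').symm)
      (by
        intro p hp
        obtain ⟨p, hp', rfl⟩ := Finset.mem_image.1 hp
        exact (hf.2 _ hp').symm) y
    exact ⟨x, hx.symm, fun p hp => (h p.swap (Finset.mem_image_of_mem _ hp)).symm⟩
  let left : X.Pos → Order.Cofinal (Subtype P) := fun x =>
    { carrier := {f | ∃ y, (x, y) ∈ f.1}
      isCofinal := by
        rintro ⟨f, hf⟩
        obtain ⟨y, hy, h⟩ := hX.exists_across hY f hf.1 hf.2 x
        exact ⟨⟨insert (x, y) f, insertP f x y hf hy h⟩, ⟨y, Finset.mem_insert_self _ _⟩,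
          Finset.subset_insert _ _⟩ }
  let right : Y.Pos → Order.Cofinal (Subtype P) := fun y =>
    { carrier := {f | ∃ x, (x, y) ∈ f.1}
      isCofinal := by
        rintro ⟨f, hf⟩
        obtain ⟨x, hx, h⟩ := across ⟨f, hf⟩ y
        exact ⟨⟨insert (x, y) f, insertP f x y hf hx h⟩, ⟨x, Finset.mem_insert_self _ _⟩,
          Finset.subset_insert _ _⟩ }
  let D : X.Pos ⊕ Y.Pos → Order.Cofinal (Subtype P) := Sum.elim left right
  let I := Order.idealOfCofinals (⟨∅, by simp [P]⟩ : Subtype P) D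
  have hF : ∀ x, ∃ y, ∃ f ∈ I, (x, y) ∈ f.1 := by
    intro x
    obtain ⟨f, ⟨y, hy⟩, hf⟩ := Order.cofinal_meets_idealOfCofinals
      (⟨∅, by simp [P]⟩ : Subtype P) D (Sum.inl x)
    exact ⟨y, f, hf, hy⟩
  have hG : ∀ y, ∃ x, ∃ f ∈ I, (x, y) ∈ f.1 := by
    intro y
    obtain ⟨f, ⟨x, hx⟩, hf⟩ := Order.cofinal_meets_idealOfCofinals
      (⟨∅, by simp [P]⟩ : Subtype P) D (Sum.inr y)
    exact ⟨x, f, hf, hx⟩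
  choose F hF using hF
  choose G hG using hG
  refine ⟨OrderIso.ofCmpEqCmp F G fun x y => ?_, fun x => ?_⟩
  · obtain ⟨f, hf, hx⟩ := hF x
    obtain ⟨g, hg, hy⟩ := hG y
    obtain ⟨m, -, fm, gm⟩ := I.directed _ hf _ hg
    exact m.2.1 (x, _) (fm hx) (_, y) (gm hy)
  · obtain ⟨f, hf, hx⟩ := hF x
    exact (f.2.2 _ hx).symm

end LabelledOrder

/-- Countable words over `A`: isomorphism classes of countable `A`-labelled linear orders. -/
def CircWord (emptyAllowed : Prop) (A : Type u) : Type (max 1 u) :=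
  Quotient (LabelledOrder.setoid emptyAllowed A)

namespace CircWord

variable {emptyAllowed : Prop} {A : Type u} {B : Type v}

/-- The word represented by a countable labelled linear order. -/
def mk (X : LabelledOrder emptyAllowed A) : CircWord emptyAllowed A :=
  Quotient.mk _ X

/-- The one-letter word. -/
def letter (emptyAllowed : Prop) (a : A) : CircWord emptyAllowed A :=
  mk { Pos := Unit, nonempty := Or.inr ⟨()⟩, label := fun _ => a }

/-- Letter-by-letter application of a function. -/
def map (f : A → B) : CircWord emptyAllowed A → CircWord emptyAllowed B :=
  Quotient.lift (fun X => mk (X.map f)) (by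
    rintro X Y ⟨e, he⟩
    exact Quotient.sound ⟨e, fun x => congrArg f (he x)⟩)

/-- Free multiplication: replace each position of a word of words by the word in its label. -/
noncomputable def flatten :
    CircWord emptyAllowed (CircWord emptyAllowed A) → CircWord emptyAllowed A :=
  Quotient.lift (fun X => mk (X.lexSum fun i => (X.label i).out)) (by
    rintro X Y ⟨e, he⟩
    refine Quotient.sound (LabelledOrder.lexSum_congr e fun i => ?_)
    rw [he i])

/-- Free multiplication does not depend on the representatives chosen for the labels. -/
theorem flatten_mk (X : LabelledOrder emptyAllowed (CircWord emptyAllowed A))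
    (Y : X.Pos → LabelledOrder emptyAllowed A) (h : ∀ i, X.label i = mk (Y i)) :
    flatten (mk X) = mk (X.lexSum Y) := by
  refine Quotient.sound (LabelledOrder.lexSum_congr (OrderIso.refl _) fun i => ?_)
  change (X.label i).out ≈ Y i
  rw [h i]
  exact Quotient.mk_out (Y i)

/-- The two-letter word `ab`. -/
def pair (emptyAllowed : Prop) (a b : A) : CircWord emptyAllowed A :=
  mk { Pos := Fin 2, nonempty := Or.inr ⟨0⟩, label := ![a, b] }

/-- The word `aaa⋯`. -/
def omega (emptyAllowed : Prop) (a : A) : CircWord emptyAllowed A :=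
  mk { Pos := ℕ, nonempty := Or.inr ⟨0⟩, label := fun _ => a }

/-- The word `⋯aaa`. -/
def omegaStar (emptyAllowed : Prop) (a : A) : CircWord emptyAllowed A :=
  mk { Pos := ℕᵒᵈ, countable := inferInstanceAs (Countable ℕ),
       nonempty := Or.inr ⟨OrderDual.toDual 0⟩, label := fun _ => a }

/-- Up to isomorphism, a countable set of letters has exactly one shuffle. -/
theorem existsUnique_shuffle {B : Set A} (hc : B.Countable) (hB : emptyAllowed ∨ B.Nonempty) :
    ∃! w : CircWord emptyAllowed A, ∃ X, X.IsShuffle B ∧ w = mk X := by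
  obtain ⟨X, hX⟩ := LabelledOrder.exists_isShuffle hc hB
  refine ⟨mk X, ⟨X, hX, rfl⟩, ?_⟩
  rintro _ ⟨Y, hY, rfl⟩
  exact Quotient.sound (hY.isIso hX)

/-- The shuffle of a countable set of letters. The set has to be nonempty, unless the empty word is
admitted (it is the shuffle of the empty set). -/
noncomputable def shuffle (B : Set A) (hc : B.Countable) (hB : emptyAllowed ∨ B.Nonempty) :
    CircWord emptyAllowed A :=
  (existsUnique_shuffle hc hB).choose

end CircWord

/-- A `∘`-semigroup: a multiplication of countable words which is the identity on one-letter words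
and is associative with respect to free multiplication. -/
structure CircSemigroup (emptyAllowed : Prop) (S : Type u) where
  mul : CircWord emptyAllowed S → S
  mul_letter : ∀ a, mul (CircWord.letter emptyAllowed a) = a
  mul_flatten : ∀ w : CircWord emptyAllowed (CircWord emptyAllowed S),
    mul w.flatten = mul (w.map mul)

namespace CircSemigroup

variable {emptyAllowed : Prop} {S : Type u} (M : CircSemigroup emptyAllowed S)

/-- Binary multiplication `ab`. -/
def prod (a b : S) : S := M.mul (CircWord.pair emptyAllowed a b)

/-- The power `a^ω`. -/
def omegaPow (a : S) : S := M.mul (CircWord.omega emptyAllowed a)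

/-- The power `a^{ω*}`. -/
def omegaStarPow (a : S) : S := M.mul (CircWord.omegaStar emptyAllowed a)

/-- The shuffle power `{a₁, …, aₙ}^η`. -/
noncomputable def shufflePow (A : Set S) (hf : A.Finite) (hA : emptyAllowed ∨ A.Nonempty) : S :=
  M.mul (CircWord.shuffle A hf.countable hA)

/-- A subset closed under the four Läuchli–Leonard operations. -/
def LLClosed (T : Set S) : Prop :=
  (∀ a ∈ T, ∀ b ∈ T, M.prod a b ∈ T) ∧ (∀ a ∈ T, M.omegaPow a ∈ T) ∧
    (∀ a ∈ T, M.omegaStarPow a ∈ T) ∧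
    ∀ (A : Set S) (hf : A.Finite) (hA : emptyAllowed ∨ A.Nonempty),
      A ⊆ T → M.shufflePow A hf hA ∈ T

/-- The sub-algebra generated by `A`: all multiplications of words over `A`. -/
def subalgebraGenerated (A : Set S) : Set S :=
  {s | ∃ w : CircWord emptyAllowed A, M.mul (w.map Subtype.val) = s}

end CircSemigroup

/-! Both parts follow from one claim, `LLClosed.mul_mk_mem`: if `S` is finite and `T` is closed
under the Läuchli–Leonard operations, every word over `T` has its product in `T`. The second part is
then immediate. For the first, the diagonal of the direct product of the two `∘`-semigroups is
closed under the operations, so the product of a doubled word lies on it.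

For the claim, call two positions equivalent if every nonempty convex subset of the closed interval
between them has its product in `T`. This is an equivalence relation with convex classes. By
Ramsey's theorem, a class is cut in each direction without end into intervals of constant product
`e`, up to a remainder; powers `e^ω` and `e^{ω*}` thus show that classes, and their convex subsets,
have products in `T` (`LLClosed.value_mem_of_forall_uIcc`).

Two adjacent classes would merge, so the classes are densely ordered. If there were several, choose
two with the fewest class products occurring strictly between them. By minimality the same products
occur between any two classes in that range, so the classes form a shuffle there. Closure under
shuffle powers makes the two chosen classes equivalent, a contradiction
(`LLClosed.value_mem_of_shuffle`, `LLClosed.convexValuesIn_uIcc`). -/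

namespace LabelledOrder

variable {emptyAllowed : Prop} {A : Type u} {B : Type v}

/-- The restriction of a labelled order to a nonempty set of positions. -/
def restrict (X : LabelledOrder emptyAllowed A) (J : Set X.Pos) (h : J.Nonempty) :
    LabelledOrder emptyAllowed A where
  Pos := J
  nonempty := Or.inr h.to_subtype
  label := fun x => X.label x

theorem IsShuffle.map {X : LabelledOrder emptyAllowed A} {C : Set A} (hX : X.IsShuffle C)
    (f : A → B) : (X.map f).IsShuffle (f '' C) := by
  obtain ⟨h1, h2, h3, h4⟩ := hX
  refine ⟨fun x => ⟨_, h1 x, rfl⟩, h2, h3, ?_⟩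
  rintro _ ⟨b, hb, rfl⟩
  obtain ⟨⟨x, hx⟩, hd⟩ := h4 b hb
  refine ⟨⟨x, congrArg f hx⟩, fun x y hxy => ?_⟩
  obtain ⟨z, hz1, hz2, hz⟩ := hd x y hxy
  exact ⟨z, hz1, hz2, congrArg f hz⟩

end LabelledOrder

/-! ### Naturality of free multiplication and of shuffles -/

namespace CircWord

variable {emptyAllowed : Prop} {A : Type u} {B : Type v}

theorem map_map {C : Type*} (f : A → B) (g : B → C) (w : CircWord emptyAllowed A) :
    (w.map f).map g = w.map (g ∘ f) := by
  induction w using Quotient.inductionOn with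
  | h X => rfl

theorem flatten_map (f : A → B) (w : CircWord emptyAllowed (CircWord emptyAllowed A)) :
    (w.map (map f)).flatten = w.flatten.map f := by
  induction w using Quotient.inductionOn with
  | h X =>
    refine (flatten_mk (X.map (map f)) (fun i => ((X.label i).out).map f) fun i => ?_).trans rfl
    change map f (X.label i) = map f (mk (X.label i).out)
    congr 1
    exact (Quotient.out_eq _).symm

theorem map_pair (f : A → B) (a b : A) :
    (pair emptyAllowed a b).map f = pair emptyAllowed (f a) (f b) := by
  refine Quotient.sound ⟨OrderIso.refl _, fun x => ?_⟩
  change ![f a, f b] x = f (![a, b] x)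
  revert x
  exact Fin.forall_fin_two.2 ⟨rfl, rfl⟩

theorem shuffle_eq_mk {C : Set A} (hc : C.Countable) (hC : emptyAllowed ∨ C.Nonempty)
    {X : LabelledOrder emptyAllowed A} (hX : X.IsShuffle C) : shuffle C hc hC = mk X :=
  ((existsUnique_shuffle hc hC).choose_spec.2 _ ⟨X, hX, rfl⟩).symm

theorem map_shuffle (f : A → B) {C : Set A} (hc : C.Countable) (hC : emptyAllowed ∨ C.Nonempty) :
    (shuffle C hc hC).map f = shuffle (f '' C) (hc.image f) (hC.imp_right (·.image f)) := by
  obtain ⟨X, hX⟩ := LabelledOrder.exists_isShuffle hc hC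
  rw [shuffle_eq_mk hc hC hX, shuffle_eq_mk _ _ (hX.map f)]
  rfl

end CircWord

/-! ### Direct products and generated sub-algebras -/

namespace CircSemigroup

open CircWord Filter

variable {emptyAllowed : Prop} {S : Type u} (M : CircSemigroup emptyAllowed S)

/-- The direct product of two `∘`-semigroups. -/
def directProduct {S' : Type v} (M' : CircSemigroup emptyAllowed S') :
    CircSemigroup emptyAllowed (S × S') where
  mul w := (M.mul (w.map Prod.fst), M'.mul (w.map Prod.snd))
  mul_letter a := Prod.ext (M.mul_letter a.1) (M'.mul_letter a.2)
  mul_flatten w := by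
    rw [← flatten_map, ← flatten_map, M.mul_flatten, M'.mul_flatten]
    simp only [CircWord.map_map]
    rfl

/-- Sub-algebras are closed under multiplication of arbitrary words. -/
theorem mul_mk_mem_subalgebraGenerated (A : Set S) (X : LabelledOrder emptyAllowed S)
    (hX : ∀ x, X.label x ∈ M.subalgebraGenerated A) :
    M.mul (CircWord.mk X) ∈ M.subalgebraGenerated A := by
  choose w hw using hX
  let W : LabelledOrder emptyAllowed (CircWord emptyAllowed A) :=
    { Pos := X.Pos, nonempty := X.nonempty, label := w }
  refine ⟨(CircWord.mk W).flatten, ?_⟩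
  rw [← flatten_map, M.mul_flatten, CircWord.map_map]
  exact congrArg (fun l => M.mul (CircWord.mk { Pos := X.Pos, nonempty := X.nonempty, label := l }))
    (funext hw)

theorem subset_subalgebraGenerated (A : Set S) : A ⊆ M.subalgebraGenerated A :=
  fun a ha => ⟨letter emptyAllowed ⟨a, ha⟩, M.mul_letter a⟩

theorem llClosed_subalgebraGenerated (A : Set S) : M.LLClosed (M.subalgebraGenerated A) := by
  refine ⟨fun a ha b hb => ?_, fun a ha => ?_, fun a ha => ?_, fun C hf hC hCA => ?_⟩
  · exact M.mul_mk_mem_subalgebraGenerated A _ (Fin.forall_fin_two.2 ⟨ha, hb⟩)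
  · exact M.mul_mk_mem_subalgebraGenerated A _ fun _ => ha
  · exact M.mul_mk_mem_subalgebraGenerated A _ fun _ => ha
  · obtain ⟨X, hX⟩ := LabelledOrder.exists_isShuffle hf.countable hC
    rw [shufflePow, shuffle_eq_mk _ _ hX]
    exact M.mul_mk_mem_subalgebraGenerated A _ fun x => hCA (hX.1 x)

/-! ### Products over sets of positions -/

section Value

variable [Nonempty S] (X : LabelledOrder emptyAllowed S)

open Classical in
/-- The product of the labels over a nonempty set of positions. -/
noncomputable def value (J : Set X.Pos) : S :=
  if h : J.Nonempty then M.mul (CircWord.mk (X.restrict J h)) else Classical.arbitrary S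

theorem value_univ (h : Nonempty X.Pos) : M.value X Set.univ = M.mul (CircWord.mk X) := by
  rw [value, dif_pos Set.univ_nonempty]
  exact congrArg M.mul (Quotient.sound ⟨OrderIso.Set.univ, fun _ => rfl⟩)

theorem value_singleton (x : X.Pos) : M.value X {x} = X.label x := by
  rw [value, dif_pos (Set.singleton_nonempty x), ← M.mul_letter (X.label x)]
  refine congrArg M.mul (Quotient.sound ⟨OrderIso.ofUnique ({x} : Set X.Pos) Unit, ?_⟩)
  rintro ⟨_, rfl⟩
  rfl

/-- Generalised associativity: the restriction to the union is the lexicographic sum of the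
restrictions to the blocks, so `mul_flatten` applies. -/
theorem value_iUnion {K : Type} [LinearOrder K] [Countable K] (hK : Nonempty K)
    (F : K → Set X.Pos) (hne : ∀ k, (F k).Nonempty)
    (hlt : ∀ k l, k < l → ∀ x ∈ F k, ∀ y ∈ F l, x < y) :
    M.value X (⋃ k, F k) =
      M.mul (CircWord.mk
        { Pos := K, nonempty := Or.inr hK, label := fun k => M.value X (F k) }) := by
  have hU : (⋃ k, F k).Nonempty := Set.nonempty_iUnion.2 ⟨hK.some, hne _⟩
  let Y : K → LabelledOrder emptyAllowed S := fun k => X.restrict (F k) (hne k)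
  let W : LabelledOrder emptyAllowed (CircWord emptyAllowed S) :=
    { Pos := K, nonempty := Or.inr hK, label := fun k => CircWord.mk (Y k) }
  have h1 : CircWord.mk (W.lexSum Y) = CircWord.mk (X.restrict _ hU) := by
    let f : (Σₗ k : K, F k) → (⋃ k, F k : Set X.Pos) := fun p =>
      ⟨(ofLex p).2.1, Set.mem_iUnion.2 ⟨(ofLex p).1, (ofLex p).2.2⟩⟩
    have hf : StrictMono f := by
      rintro ⟨k, x⟩ ⟨l, y⟩ h
      rcases Sigma.Lex.lt_def.1 h with h | ⟨h, h'⟩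
      · exact hlt k l h x x.2 y y.2
      · have hkl : k = l := h
        subst hkl
        exact h'
    have hs : Function.Surjective f := by
      rintro ⟨x, hx⟩
      obtain ⟨k, hk⟩ := Set.mem_iUnion.1 hx
      exact ⟨toLex ⟨k, x, hk⟩, rfl⟩
    exact Quotient.sound ⟨StrictMono.orderIsoOfSurjective f hf hs, fun _ => rfl⟩
  rw [value, dif_pos hU, ← h1, ← flatten_mk W Y fun _ => rfl, M.mul_flatten]
  refine congrArg (fun l => M.mul (CircWord.mk { Pos := K, nonempty := Or.inr hK, label := l }))
    (funext fun k => ?_)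
  rw [value, dif_pos (hne k)]

theorem value_union {I J : Set X.Pos} (hI : I.Nonempty) (hJ : J.Nonempty)
    (h : ∀ x ∈ I, ∀ y ∈ J, x < y) :
    M.value X (I ∪ J) = M.prod (M.value X I) (M.value X J) := by
  have hU : I ∪ J = ⋃ k, (![I, J] : Fin 2 → Set X.Pos) k := by
    ext x
    simp [Fin.exists_fin_two]
  rw [hU, M.value_iUnion X ⟨0⟩ ![I, J] (Fin.forall_fin_two.2 ⟨hI, hJ⟩)
    (by simpa [Fin.forall_fin_two] using h)]
  refine congrArg
    (fun l => M.mul (CircWord.mk { Pos := Fin 2, nonempty := Or.inr ⟨0⟩, label := l }))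
    (funext (Fin.forall_fin_two.2 ⟨rfl, rfl⟩))

theorem value_iUnion_nat {F : ℕ → Set X.Pos} {e : S} (hne : ∀ k, (F k).Nonempty)
    (hlt : ∀ k l, k < l → ∀ x ∈ F k, ∀ y ∈ F l, x < y) (he : ∀ k, M.value X (F k) = e) :
    M.value X (⋃ k, F k) = M.omegaPow e := by
  rw [M.value_iUnion X ⟨0⟩ F hne hlt]
  simp only [he]
  rfl

theorem value_iUnion_nat_dual {F : ℕ → Set X.Pos} {e : S} (hne : ∀ k, (F k).Nonempty)
    (hlt : ∀ k l, k < l → ∀ x ∈ F k, ∀ y ∈ F l, y < x) (he : ∀ k, M.value X (F k) = e) :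
    M.value X (⋃ k, F k) = M.omegaStarPow e := by
  have : Countable ℕᵒᵈ := inferInstanceAs (Countable ℕ)
  refine (M.value_iUnion X (K := ℕᵒᵈ) ⟨OrderDual.toDual 0⟩ (fun k => F (OrderDual.ofDual k))
    (fun k => hne _) (fun k l hkl x hx y hy => hlt _ _ hkl y hy x hx)).trans ?_
  simp only [he]
  rfl

/-- In a countable order without maximum, pairs coloured by finitely many colours admit a cofinal
increasing sequence with constant colour. -/
theorem _root_.exists_cofinal_seq_const_color {α : Type*} [LinearOrder α] [Countable α] [Nonempty α]
    [NoMaxOrder α] {C : Type*} [Finite C] (c : α → α → C) :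
    ∃ (u : ℕ → α) (e : C), StrictMono u ∧ (∀ x, ∃ n, x ≤ u n) ∧
      ∀ m n, m < n → c (u m) (u n) = e := by
  obtain ⟨u, -, hu⟩ := exists_seq_monotone_tendsto_atTop_atTop α
  -- Ultrafilter proof of Ramsey's theorem: along a nonprincipal ultrafilter, every finite colouring
  -- is eventually constant.
  have lim : ∀ g : ℕ → C, ∃ d, ∀ᶠ n in (hyperfilter ℕ : Filter ℕ), g n = d := by
    intro g
    obtain ⟨d, hd⟩ := Ultrafilter.eventually_exists_iff.1
      (Eventually.of_forall fun n => ⟨g n, rfl⟩ :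
        ∀ᶠ n in (hyperfilter ℕ : Filter ℕ), ∃ d, g n = d)
    exact ⟨d, hd⟩
  choose d hd using fun m => lim fun n => c (u m) (u n)
  obtain ⟨e, he⟩ := lim d
  have hle : (hyperfilter ℕ : Filter ℕ) ≤ atTop := Nat.hyperfilter_le_atTop
  -- Only indices with limit colour `e` are chosen, so for finitely many of them, almost every `n`
  -- gives colour `e` with all and can be chosen next.
  obtain ⟨s, -, hs⟩ := exists_seq_of_forall_finset_exists (fun n => d n = e)
    (fun m n => m < n ∧ u m < u n ∧ c (u m) (u n) = e) (by
      intro F hF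
      have h : ∀ᶠ n in (hyperfilter ℕ : Filter ℕ),
          ∀ m ∈ F, m < n ∧ u m < u n ∧ c (u m) (u n) = e := by
        refine (eventually_all_finset F).2 fun m hm => ?_
        filter_upwards [hle (eventually_gt_atTop m), hle (hu.eventually_gt_atTop (u m)), hd m]
          with n h1 h2 h3
        exact ⟨h1, h2, h3.trans (hF m hm)⟩
      obtain ⟨n, h1, h2⟩ := (he.and h).exists
      exact ⟨n, h1, h2⟩)
  have hs' : StrictMono s := fun m n h => (hs m n h).1
  refine ⟨u ∘ s, e, fun m n h => (hs m n h).2.1, fun x => ?_, fun m n h => (hs m n h).2.2⟩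
  obtain ⟨n, hn⟩ := ((hu.comp hs'.tendsto_atTop).eventually_ge_atTop x).exists
  exact ⟨n, hn⟩

/-! ### Convex sets with products in a closed set -/

variable (T : Set S)

/-- Every nonempty convex subset of `I` has its value in `T`. -/
def ConvexValuesIn (I : Set X.Pos) : Prop :=
  ∀ J ⊆ I, J.OrdConnected → J.Nonempty → M.value X J ∈ T

variable {M X T}

/-- Either piece may be empty, where `value` is only a default; hence the guarded hypotheses. -/
theorem LLClosed.value_mem_of_split (hT : M.LLClosed T) {I J L : Set X.Pos} (hL : L = I ∪ J)
    (hI : I.Nonempty → M.value X I ∈ T) (hJ : J.Nonempty → M.value X J ∈ T)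
    (h : ∀ x ∈ I, ∀ y ∈ J, x < y) (hne : L.Nonempty) : M.value X L ∈ T := by
  subst hL
  rcases I.eq_empty_or_nonempty with rfl | hI'
  · rw [Set.empty_union] at hne ⊢
    exact hJ hne
  rcases J.eq_empty_or_nonempty with rfl | hJ'
  · rw [Set.union_empty] at hne ⊢
    exact hI hne
  rw [M.value_union X hI' hJ' h]
  exact hT.1 _ (hI hI') _ (hJ hJ')

theorem ConvexValuesIn.mono {I J : Set X.Pos} (h : M.ConvexValuesIn X T J) (hIJ : I ⊆ J) :
    M.ConvexValuesIn X T I :=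
  fun L hL => h L (hL.trans hIJ)

/-- A convex set is cut at `y`. If `y` lies outside the interval, one piece is empty and no separate
case is needed. -/
theorem LLClosed.convexValuesIn_trans (hT : M.LLClosed T) {x y z : X.Pos}
    (hxy : M.ConvexValuesIn X T (Set.uIcc x y)) (hyz : M.ConvexValuesIn X T (Set.uIcc y z)) :
    M.ConvexValuesIn X T (Set.uIcc x z) := by
  wlog hxz : x ≤ z generalizing x z
  · rw [Set.uIcc_comm]
    exact this (by rwa [Set.uIcc_comm]) (by rwa [Set.uIcc_comm]) (le_of_not_ge hxz)
  intro J hJ hc hne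
  rw [Set.uIcc_of_le hxz] at hJ
  refine hT.value_mem_of_split (Set.inter_union_compl J (Set.Iio y)).symm
    (hxy _ ?_ (hc.inter Set.ordConnected_Iio)) (hyz _ ?_ ?_) ?_ hne
  · rintro w ⟨hw, hwy⟩
    exact Set.Icc_subset_uIcc ⟨(hJ hw).1, le_of_lt hwy⟩
  · rintro w ⟨hw, hwy⟩
    exact Set.Icc_subset_uIcc ⟨le_of_not_gt hwy, (hJ hw).2⟩
  · rw [Set.compl_Iio]
    exact hc.inter Set.ordConnected_Ici
  · rintro a ⟨-, ha⟩ b ⟨-, hb⟩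
    exact lt_of_lt_of_le ha (le_of_not_gt hb)

/-! ### Ramsey's theorem and the ω- and ω*-powers -/

variable [Finite S]

/-- Without a maximum, a cofinal sequence `v` with constant product `e` on the intervals `[v n, v (n
+ 1))` makes the tail the initial piece `[x, v 0)`, if nonempty, followed by `e^ω`. -/
theorem LLClosed.value_inter_Ici_mem (hT : M.LLClosed T) {J : Set X.Pos} (hc : J.OrdConnected)
    (h : ∀ x ∈ J, ∀ y ∈ J, M.ConvexValuesIn X T (Set.uIcc x y)) {x : X.Pos} (hx : x ∈ J) :
    M.value X (J ∩ Set.Ici x) ∈ T := by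
  by_cases hmax : ∃ y ∈ J, ∀ z ∈ J, z ≤ y
  · obtain ⟨y, hy, hm⟩ := hmax
    exact h x hx y hy _ (fun z hz => Set.Icc_subset_uIcc ⟨hz.2, hm z hz.1⟩)
      (hc.inter Set.ordConnected_Ici) ⟨x, hx, Set.mem_Ici.2 le_rfl⟩
  push Not at hmax
  have : Nonempty J := ⟨⟨x, hx⟩⟩
  have : NoMaxOrder J := ⟨fun y => let ⟨z, hz, hyz⟩ := hmax y y.2; ⟨⟨z, hz⟩, hyz⟩⟩
  have : Nonempty (Set.Ici (⟨x, hx⟩ : J)) := ⟨⟨_, Set.mem_Ici.2 le_rfl⟩⟩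
  obtain ⟨u, e, hu, hcof, he⟩ := exists_cofinal_seq_const_color
    (α := Set.Ici (⟨x, hx⟩ : J)) fun a b => M.value X (Set.Ico a.1.1 b.1.1)
  set v : ℕ → X.Pos := fun n => (u n).1.1 with hv
  have hvJ : ∀ n, v n ∈ J := fun n => (u n).1.2
  have hv' : StrictMono v := hu
  have hxv : ∀ n, x ≤ v n := fun n => (u n).2
  have hIco : ∀ a ∈ J, ∀ b ∈ J, (Set.Ico a b).Nonempty → M.value X (Set.Ico a b) ∈ T :=
    fun a ha b hb => h a ha b hb _ (Set.Ico_subset_Icc_self.trans Set.Icc_subset_uIcc)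
      Set.ordConnected_Ico
  have hne : ∀ n, (Set.Ico (v n) (v (n + 1))).Nonempty :=
    fun n => Set.nonempty_Ico.2 (hv' n.lt_succ_self)
  have heT : e ∈ T := by
    rw [← he 0 1 one_pos]
    exact hIco _ (hvJ 0) _ (hvJ 1) (hne 0)
  refine hT.value_mem_of_split (I := Set.Ico x (v 0)) (J := ⋃ n, Set.Ico (v n) (v (n + 1))) ?_
    (hIco _ hx _ (hvJ 0)) (fun _ => ?_) ?_ ⟨x, hx, Set.mem_Ici.2 le_rfl⟩
  · ext z
    simp only [Set.mem_inter_iff, Set.mem_Ici, Set.mem_union, Set.mem_Ico, Set.mem_iUnion]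
    constructor
    · rintro ⟨hz, hxz⟩
      rcases lt_or_ge z (v 0) with hlt | hge
      · exact Or.inl ⟨hxz, hlt⟩
      · right
        obtain ⟨n, hn⟩ := hcof ⟨⟨z, hz⟩, hxz⟩
        have hn' : z < v (n + 1) := lt_of_le_of_lt hn (hv' n.lt_succ_self)
        clear hn
        -- Descend from an index whose term exceeds `z` to the block containing `z`.
        induction n with
        | zero => exact ⟨0, hge, hn'⟩
        | succ n ih =>
          rcases lt_or_ge z (v (n + 1)) with h1 | h1
          · exact ih h1
          · exact ⟨n + 1, h1, hn'⟩
    · rintro (⟨h1, h2⟩ | ⟨n, h1, h2⟩)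
      · exact ⟨hc.out hx (hvJ 0) ⟨h1, h2.le⟩, h1⟩
      · exact ⟨hc.out (hvJ n) (hvJ (n + 1)) ⟨h1, h2.le⟩, (hxv n).trans h1⟩
  · rw [M.value_iUnion_nat X hne (fun k l hkl a ha b hb =>
      ha.2.trans_le ((hv'.monotone (Nat.succ_le_of_lt hkl)).trans hb.1))
      fun n => he n (n + 1) n.lt_succ_self]
    exact hT.2.1 e heT
  · rintro a ha b hb
    obtain ⟨n, hn⟩ := Set.mem_iUnion.1 hb
    exact ha.2.trans_le ((hv'.monotone n.zero_le).trans hn.1)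

/-- Mirror image: a coinitial decreasing sequence, found in the order dual, and half-open intervals
closed on the right. -/
theorem LLClosed.value_inter_Iic_mem (hT : M.LLClosed T) {J : Set X.Pos} (hc : J.OrdConnected)
    (h : ∀ x ∈ J, ∀ y ∈ J, M.ConvexValuesIn X T (Set.uIcc x y)) {x : X.Pos} (hx : x ∈ J) :
    M.value X (J ∩ Set.Iic x) ∈ T := by
  by_cases hmin : ∃ y ∈ J, ∀ z ∈ J, y ≤ z
  · obtain ⟨y, hy, hm⟩ := hmin
    exact h y hy x hx _ (fun z hz => Set.Icc_subset_uIcc ⟨hm z hz.1, hz.2⟩)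
      (hc.inter Set.ordConnected_Iic) ⟨x, hx, Set.mem_Iic.2 le_rfl⟩
  push Not at hmin
  have : Nonempty J := ⟨⟨x, hx⟩⟩
  have : NoMinOrder J := ⟨fun y => let ⟨z, hz, hyz⟩ := hmin y y.2; ⟨⟨z, hz⟩, hyz⟩⟩
  have : Nonempty (Set.Iic (⟨x, hx⟩ : J))ᵒᵈ := ⟨OrderDual.toDual ⟨_, Set.mem_Iic.2 le_rfl⟩⟩
  have : Countable (Set.Iic (⟨x, hx⟩ : J))ᵒᵈ := inferInstanceAs (Countable (Set.Iic _))
  obtain ⟨u, e, hu, hcof, he⟩ := exists_cofinal_seq_const_color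
    (α := (Set.Iic (⟨x, hx⟩ : J))ᵒᵈ) fun a b =>
      M.value X (Set.Ioc (OrderDual.ofDual b).1.1 (OrderDual.ofDual a).1.1)
  set v : ℕ → X.Pos := fun n => (OrderDual.ofDual (u n)).1.1 with hv
  have hvJ : ∀ n, v n ∈ J := fun n => (OrderDual.ofDual (u n)).1.2
  have hv' : StrictAnti v := hu
  have hxv : ∀ n, v n ≤ x := fun n => (OrderDual.ofDual (u n)).2
  have hIoc : ∀ a ∈ J, ∀ b ∈ J, (Set.Ioc a b).Nonempty → M.value X (Set.Ioc a b) ∈ T :=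
    fun a ha b hb => h a ha b hb _ (Set.Ioc_subset_Icc_self.trans Set.Icc_subset_uIcc)
      Set.ordConnected_Ioc
  have hne : ∀ n, (Set.Ioc (v (n + 1)) (v n)).Nonempty :=
    fun n => Set.nonempty_Ioc.2 (hv' n.lt_succ_self)
  have heT : e ∈ T := by
    rw [← he 0 1 one_pos]
    exact hIoc _ (hvJ 1) _ (hvJ 0) (hne 0)
  refine hT.value_mem_of_split (I := ⋃ n, Set.Ioc (v (n + 1)) (v n)) (J := Set.Ioc (v 0) x) ?_
    (fun _ => ?_) (hIoc _ (hvJ 0) _ hx) ?_ ⟨x, hx, Set.mem_Iic.2 le_rfl⟩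
  · ext z
    simp only [Set.mem_inter_iff, Set.mem_Iic, Set.mem_union, Set.mem_Ioc, Set.mem_iUnion]
    constructor
    · rintro ⟨hz, hxz⟩
      rcases lt_or_ge (v 0) z with hlt | hge
      · exact Or.inr ⟨hlt, hxz⟩
      · left
        obtain ⟨n, hn⟩ := hcof (OrderDual.toDual ⟨⟨z, hz⟩, hxz⟩)
        have hn' : v (n + 1) < z := lt_of_lt_of_le (hv' n.lt_succ_self) hn
        clear hn
        induction n with
        | zero => exact ⟨0, hn', hge⟩
        | succ n ih =>
          rcases lt_or_ge (v (n + 1)) z with h1 | h1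
          · exact ih h1
          · exact ⟨n + 1, hn', h1⟩
    · rintro (⟨n, h1, h2⟩ | ⟨h1, h2⟩)
      · exact ⟨hc.out (hvJ (n + 1)) (hvJ n) ⟨h1.le, h2⟩, h2.trans (hxv n)⟩
      · exact ⟨hc.out (hvJ 0) hx ⟨h1.le, h2⟩, h2⟩
  · rw [M.value_iUnion_nat_dual X hne (fun k l hkl a ha b hb =>
      (hb.2.trans (hv'.antitone (Nat.succ_le_of_lt hkl))).trans_lt ha.1)
      fun n => he n (n + 1) n.lt_succ_self]
    exact hT.2.2.1 e heT
  · rintro a ha b hb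
    obtain ⟨n, hn⟩ := Set.mem_iUnion.1 ha
    exact (hn.2.trans (hv'.antitone n.zero_le)).trans_lt hb.1

/-- A convex set has its value in `T` as soon as all its closed subintervals do, hereditarily. -/
theorem LLClosed.value_mem_of_forall_uIcc (hT : M.LLClosed T) {J : Set X.Pos}
    (hc : J.OrdConnected) (h : ∀ x ∈ J, ∀ y ∈ J, M.ConvexValuesIn X T (Set.uIcc x y))
    (hne : J.Nonempty) : M.value X J ∈ T := by
  obtain ⟨x, hx⟩ := hne
  by_cases hlt : (J ∩ Set.Iio x).Nonempty
  · refine hT.value_mem_of_split (I := J ∩ Set.Iio x) (J := J ∩ Set.Ici x) ?_ (fun _ => ?_)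
      (fun _ => hT.value_inter_Ici_mem hc h hx) ?_ ⟨x, hx⟩
    · rw [← Set.inter_union_distrib_left, Set.Iio_union_Ici, Set.inter_univ]
    · have hc' : (J ∩ Set.Iio x).OrdConnected := hc.inter Set.ordConnected_Iio
      obtain ⟨y, hy⟩ := hlt
      -- The pieces below and above must not share `x`, so the lower one is closed off at some `y <
      -- x` and the gap `(y, x)` is treated as part of a closed interval.
      refine hT.value_mem_of_split (I := (J ∩ Set.Iio x) ∩ Set.Iic y) (J := J ∩ Set.Ioo y x) ?_
        (fun _ => hT.value_inter_Iic_mem hc' (fun a ha b hb => h a ha.1 b hb.1) hy)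
        (h y hy.1 x hx _ ?_ (hc.inter Set.ordConnected_Ioo)) ?_ ⟨y, hy⟩
      · ext z
        have hyx : y < x := hy.2
        simp only [Set.mem_inter_iff, Set.mem_union, Set.mem_Iio, Set.mem_Iic, Set.mem_Ioo]
        have := le_or_gt z y
        tauto
      · exact fun z hz => Set.Icc_subset_uIcc ⟨hz.2.1.le, hz.2.2.le⟩
      · exact fun a ha b hb => lt_of_le_of_lt ha.2 hb.2.1
    · exact fun a ha b hb => lt_of_lt_of_le ha.2 hb.2
  · have hJ : J = J ∩ Set.Ici x := by
      ext z
      refine ⟨fun hz => ⟨hz, le_of_not_gt fun hzx => hlt ⟨z, hz, hzx⟩⟩, And.left⟩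
    rw [hJ]
    exact hT.value_inter_Ici_mem hc h hx

/-! ### Condensation and shuffles -/

/-- If the values of the fibres of `rep`, a monotone choice of representatives, lie in `T`, then so
does the value of a convex set for which these fibres form a shuffle, apart from extremal ones. -/
theorem LLClosed.value_mem_of_shuffle (hT : M.LLClosed T) {rep : X.Pos → X.Pos}
    (hmono : Monotone rep) (hidem : ∀ x, rep (rep x) = rep x)
    (hfib : ∀ x, ∀ J : Set X.Pos, J.OrdConnected → J.Nonempty → (∀ y ∈ J, rep y = x) →
      M.value X J ∈ T)
    {J : Set X.Pos} (hc : J.OrdConnected) (hne : J.Nonempty) {B : Set S}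
    (hB : ∀ x ∈ J, ∀ y ∈ J, rep x < rep y →
      (fun r => M.value X (rep ⁻¹' {r})) '' {r | rep r = r ∧ rep x < r ∧ r < rep y} = B)
    (hBne : B.Nonempty) :
    M.value X J ∈ T := by
  have hlt : ∀ {x y}, rep x < rep y → x < y := fun h => hmono.reflect_lt h
  -- The lowest fibre, the interior and the highest fibre. Only the extremal fibres can be cut by
  -- `J`; a fibre that is both lowest and highest counts only in `I₁`.
  let I₁ : Set X.Pos := {x | x ∈ J ∧ ∀ y ∈ J, rep x ≤ rep y}
  let I₂ : Set X.Pos := {x | x ∈ J ∧ (∃ y ∈ J, rep y < rep x) ∧ ∃ z ∈ J, rep x < rep z}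
  let I₃ : Set X.Pos := {x | x ∈ J ∧ (∃ y ∈ J, rep y < rep x) ∧ ∀ y ∈ J, rep y ≤ rep x}
  have hJ : J = I₁ ∪ (I₂ ∪ I₃) := by
    ext x
    constructor
    · intro hx
      by_cases h1 : ∀ y ∈ J, rep x ≤ rep y
      · exact Or.inl ⟨hx, h1⟩
      · push Not at h1
        by_cases h2 : ∀ y ∈ J, rep y ≤ rep x
        · exact Or.inr (Or.inr ⟨hx, h1, h2⟩)
        · push Not at h2
          exact Or.inr (Or.inl ⟨hx, h1, h2⟩)
    · rintro (h | h | h) <;> exact h.1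
  have hmem : ∀ {x y z}, x ∈ J → y ∈ J → rep x < rep z → rep z < rep y → z ∈ I₂ :=
    fun {x y z} hx hy h1 h2 =>
      ⟨hc.out hx hy ⟨(hlt h1).le, (hlt h2).le⟩, ⟨x, hx, h1⟩, ⟨y, hy, h2⟩⟩
  have hbetween : ∀ {x y}, x ∈ J → y ∈ J → rep x < rep y → ∀ b ∈ B,
      ∃ r ∈ I₂, rep r = r ∧ rep x < r ∧ r < rep y ∧ M.value X (rep ⁻¹' {r}) = b := by
    intro x y hx hy hxy b hb
    rw [← hB x hx y hy hxy] at hb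
    obtain ⟨r, ⟨h1, h2, h3⟩, h4⟩ := hb
    exact ⟨r, hmem hx hy (h1.symm ▸ h2) (h1.symm ▸ h3), h1, h2, h3, h4⟩
  have hfibne : ∀ r, rep r = r → (rep ⁻¹' {r}).Nonempty := fun r hr => ⟨r, hr⟩
  have hI₂ : I₂.Nonempty → M.value X I₂ ∈ T := by
    rintro ⟨x₀, hx₀J, ⟨y₀, hy₀, hyx₀⟩, z₀, hz₀, hxz₀⟩
    let R : Set X.Pos := {r | r ∈ I₂ ∧ rep r = r}
    have hR : Nonempty R := by
      obtain ⟨b, hb⟩ := hBne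
      obtain ⟨r, h1, h2, -⟩ := hbetween hy₀ hz₀ (hyx₀.trans hxz₀) b hb
      exact ⟨⟨r, h1, h2⟩⟩
    -- Since `J` is convex, the interior is a union of entire fibres, indexed by their
    -- representatives.
    have hU : I₂ = ⋃ r : R, rep ⁻¹' {r.1} := by
      ext x
      simp only [Set.mem_iUnion, Set.mem_preimage, Set.mem_singleton_iff]
      constructor
      · rintro ⟨-, ⟨y, hy, hyx⟩, z, hz, hxz⟩
        have hr : rep x ∈ I₂ := hmem hy hz (by rwa [hidem]) (by rwa [hidem])
        exact ⟨⟨rep x, hr, hidem x⟩, rfl⟩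
      · rintro ⟨⟨r, ⟨_, ⟨y, hy, hyx⟩, z, hz, hxz⟩, hr⟩, hxr⟩
        have hxr' : rep x = rep r := hxr.trans hr.symm
        exact hmem hy hz (hxr' ▸ hyx) (hxr' ▸ hxz)
    rw [hU, M.value_iUnion X hR (fun r : R => rep ⁻¹' {r.1}) (fun r => hfibne _ r.2.2) (by
      intro r s hrs x hx y hy
      have hx' : rep x = r := hx
      have hy' : rep y = s := hy
      exact hlt (by rw [hx', hy']; exact hrs))]
    have hBT : B ⊆ T := by
      intro b hb
      obtain ⟨r, -, hr, -, -, rfl⟩ := hbetween hy₀ hz₀ (hyx₀.trans hxz₀) b hb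
      exact hfib r _ (Set.ordConnected_singleton.preimage_mono hmono) (hfibne r hr) fun y hy => hy
    have hmid : ∀ x : R, ∀ y : R, x < y → ∀ b ∈ B, ∃ z : R, x < z ∧ z < y ∧
        M.value X (rep ⁻¹' {z.1}) = b := by
      intro x y hxy b hb
      obtain ⟨r, h1, h2, h3, h4, h5⟩ := hbetween x.2.1.1 y.2.1.1
        (by rw [x.2.2, y.2.2]; exact hxy) b hb
      rw [x.2.2] at h3
      rw [y.2.2] at h4
      exact ⟨⟨r, h1, h2⟩, h3, h4, h5⟩
    have hS : LabelledOrder.IsShuffle (emptyAllowed := emptyAllowed)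
        { Pos := R, nonempty := Or.inr hR, label := fun r => M.value X (rep ⁻¹' {r.1}) } B := by
      obtain ⟨b₀, hb₀⟩ := hBne
      refine ⟨?_, ?_, ?_, fun b hb => ⟨?_, fun x y hxy => hmid x y hxy b hb⟩⟩
      · rintro ⟨r, ⟨-, ⟨y, hy, hyr⟩, z, hz, hrz⟩, hr⟩
        rw [← hB y hy z hz (hyr.trans hrz)]
        exact ⟨r, ⟨hr, hr ▸ hyr, hr ▸ hrz⟩, rfl⟩
      · rintro ⟨r, ⟨hrJ, ⟨y, hy, hyr⟩, -⟩, hr⟩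
        obtain ⟨s, h1, h2, h3, h4, -⟩ := hbetween hy hrJ hyr b₀ hb₀
        exact ⟨⟨s, h1, h2⟩, Subtype.mk_lt_mk.2 (h4.trans_eq hr)⟩
      · rintro ⟨r, ⟨hrJ, -, z, hz, hrz⟩, hr⟩
        obtain ⟨s, h1, h2, h3, h4, -⟩ := hbetween hrJ hz hrz b₀ hb₀
        exact ⟨⟨s, h1, h2⟩, Subtype.mk_lt_mk.2 (hr.symm.trans_lt h3)⟩
      · obtain ⟨r, h1, h2, h3, h4, h5⟩ := hbetween hy₀ hz₀ (hyx₀.trans hxz₀) b hb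
        exact ⟨⟨r, h1, h2⟩, h5⟩
    have := hT.2.2.2 B B.toFinite (Or.inr hBne) hBT
    rwa [shufflePow, shuffle_eq_mk _ _ hS] at this
  have hend : ∀ I ⊆ J, (∀ x ∈ I, ∀ y ∈ I, rep x = rep y) →
      (∀ x ∈ I, ∀ y ∈ J, rep y = rep x → y ∈ I) → I.Nonempty → M.value X I ∈ T := by
    rintro I hIJ h1 h2 ⟨x, hx⟩
    refine hfib (rep x) I ⟨fun a ha b hb c hcab => ?_⟩ ⟨x, hx⟩ fun y hy => h1 y hy x hx
    exact h2 a ha c (hc.out (hIJ ha) (hIJ hb) hcab)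
      (le_antisymm ((hmono hcab.2).trans (h1 b hb a ha).le) (hmono hcab.1))
  refine hT.value_mem_of_split hJ (hend I₁ (fun x hx => hx.1)
    (fun x hx y hy => le_antisymm (hx.2 y hy.1) (hy.2 x hx.1))
    fun x hx y hy hyx => ⟨hy, by rw [hyx]; exact hx.2⟩)
    (hT.value_mem_of_split rfl hI₂ (hend I₃ (fun x hx => hx.1)
      (fun x hx y hy => le_antisymm (hy.2.2 x hx.1) (hx.2.2 y hy.1))
      fun x hx y hy hyx => ⟨hy, by rw [hyx]; exact hx.2⟩) ?_) ?_ hne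
  · rintro x ⟨-, -, z, hz, hxz⟩ y ⟨-, -, hy⟩
    exact hlt (hxz.trans_le (hy z hz))
  · rintro x ⟨-, hx⟩ y (⟨-, ⟨z, hz, hzy⟩, -⟩ | ⟨-, ⟨z, hz, hzy⟩, -⟩) <;>
      exact hlt ((hx z hz).trans_lt hzy)

/-- The condensation argument: all positions are equivalent. Chosen representatives stand in for the
quotient order. -/
theorem LLClosed.convexValuesIn_uIcc (hT : M.LLClosed T) (hX : ∀ x, X.label x ∈ T) (x y : X.Pos) :
    M.ConvexValuesIn X T (Set.uIcc x y) := by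
  let r : Setoid X.Pos :=
    { r := fun x y => M.ConvexValuesIn X T (Set.uIcc x y)
      iseqv :=
        { refl := fun x J hJ _ hne => by
            rw [Set.uIcc_self] at hJ
            rw [hne.subset_singleton_iff.1 hJ, value_singleton]
            exact hX x
          symm := fun h => by rwa [Set.uIcc_comm]
          trans := hT.convexValuesIn_trans } }
  let rep : X.Pos → X.Pos := fun x => (Quotient.mk r x).out
  have hrep : ∀ x, r (rep x) x := fun x => Quotient.mk_out x
  have hrep_eq : ∀ {x y}, r x y → rep x = rep y :=
    fun h => congrArg Quotient.out (Quotient.sound h)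
  have hrel : ∀ {x y}, rep x = rep y → r x y := fun {x y} h =>
    r.trans (r.symm (hrep x)) (h ▸ hrep y)
  have hidem : ∀ x, rep (rep x) = rep x := fun x => hrep_eq (hrep x)
  have hconv : ∀ {x y z}, r x z → x ≤ y → y ≤ z → rep x = rep y := fun h hxy hyz =>
    hrep_eq (h.mono (Set.uIcc_subset_uIcc_left (Set.Icc_subset_uIcc ⟨hxy, hyz⟩)))
  -- If representatives were reversed, then `x` would lie between `rep y` and `y`, or `rep y`
  -- between `x` and `rep x`; convexity of classes would identify the two classes.
  have hmono : Monotone rep := by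
    intro x y hxy
    by_contra! hlt
    rcases le_or_gt (rep y) x with h | h
    · have := hconv (hrep y) h hxy
      rw [hidem] at this
      exact hlt.ne this
    · have := hconv (r.symm (hrep x)) h.le hlt.le
      rw [hidem] at this
      exact hlt.ne this.symm
  have hfib : ∀ x, ∀ J : Set X.Pos, J.OrdConnected → J.Nonempty → (∀ y ∈ J, rep y = x) →
      M.value X J ∈ T := fun x J hc hne h =>
    hT.value_mem_of_forall_uIcc hc (fun a ha b hb => hrel ((h a ha).trans (h b hb).symm)) hne
  let between : X.Pos × X.Pos → Set X.Pos := fun p => {s | rep s = s ∧ rep p.1 < s ∧ s < rep p.2}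
  -- With no class in between, a convex subset of `[a, b]` splits into at most two convex pieces of
  -- single classes, so `a` and `b` would be equivalent.
  have hdense : ∀ p : X.Pos × X.Pos, rep p.1 < rep p.2 → (between p).Nonempty := by
    rintro ⟨a, b⟩ hab
    by_contra hempty
    have hor : ∀ z, rep a ≤ rep z → rep z ≤ rep b → rep z = rep a ∨ rep z = rep b := by
      intro z h1 h2
      by_contra! h
      exact hempty ⟨rep z, hidem z, lt_of_le_of_ne h1 h.1.symm, lt_of_le_of_ne h2 h.2⟩
    refine hab.ne (hrep_eq (x := a) (y := b) fun J hJ hc hne => ?_)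
    rw [Set.uIcc_of_le (hmono.reflect_lt hab).le] at hJ
    refine hT.value_mem_of_split (I := J ∩ rep ⁻¹' {rep a}) (J := J ∩ rep ⁻¹' {rep b}) ?_
      (fun h => hfib (rep a) _ (hc.inter (Set.ordConnected_singleton.preimage_mono hmono)) h
        fun y hy => hy.2)
      (fun h => hfib (rep b) _ (hc.inter (Set.ordConnected_singleton.preimage_mono hmono)) h
        fun y hy => hy.2) ?_ hne
    · rw [← Set.inter_union_distrib_left, eq_comm, Set.inter_eq_left]
      exact fun z hz => hor z (hmono (hJ hz).1) (hmono (hJ hz).2)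
    · rintro u ⟨-, hu⟩ v ⟨-, hv⟩
      refine hmono.reflect_lt ?_
      rw [show rep u = rep a from hu, show rep v = rep b from hv]
      exact hab
  by_contra hxy
  have hP : {p : X.Pos × X.Pos | rep p.1 < rep p.2}.Nonempty := by
    rcases lt_trichotomy (rep x) (rep y) with h | h | h
    · exact ⟨(x, y), h⟩
    · exact absurd (hrel h) hxy
    · exact ⟨(y, x), h⟩
  let color : X.Pos × X.Pos → Set S := fun p =>
    (fun s => M.value X (rep ⁻¹' {s})) '' between p
  -- The fewest products between two classes: shrinking the interval can only lose products, hence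
  -- by minimality loses none.
  obtain ⟨⟨a, b⟩, hab, hmin⟩ :=
    (measure fun p : X.Pos × X.Pos => (color p).ncard).wf.has_min _ hP
  have hab' : rep a < rep b := hab
  refine hab'.ne (hrep_eq (x := a) (y := b) fun J hJ hc hne => ?_)
  rw [Set.uIcc_of_le (hmono.reflect_lt hab').le] at hJ
  refine hT.value_mem_of_shuffle hmono hidem hfib hc hne (B := color (a, b))
    (fun u hu v hv huv => ?_) ((hdense _ hab).image _)
  refine Set.eq_of_subset_of_ncard_le (Set.image_mono ?_) (not_lt.1 (hmin (u, v) huv))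
    (Set.toFinite _)
  rintro s ⟨h1, h2, h3⟩
  exact ⟨h1, (hmono (hJ hu).1).trans_lt h2, h3.trans_le (hmono (hJ hv).2)⟩

end Value

/-! ### Closed sets, generation and uniqueness -/

variable {M} in
/-- A set closed under the Läuchli–Leonard operations is closed under multiplication of words. -/
theorem LLClosed.mul_mk_mem [Finite S] {T : Set S} (hT : M.LLClosed T)
    (X : LabelledOrder emptyAllowed S) (hX : ∀ x, X.label x ∈ T) : M.mul (CircWord.mk X) ∈ T := by
  -- The empty word, if admitted, is the shuffle of `∅`; otherwise a label witnesses that `S` is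
  -- nonempty, as `value` requires.
  rcases isEmpty_or_nonempty X.Pos with hE | hN
  · have hA : emptyAllowed := X.nonempty.resolve_right (not_nonempty_iff.2 hE)
    have hS : X.IsShuffle ∅ := ⟨fun x => hE.elim x, fun x => hE.elim x, fun x => hE.elim x,
      fun b hb => hb.elim⟩
    have := hT.2.2.2 ∅ Set.finite_empty (Or.inl hA) (Set.empty_subset T)
    rwa [shufflePow, shuffle_eq_mk _ _ hS] at this
  · have : Nonempty S := hN.map X.label
    rw [← M.value_univ X hN]
    exact hT.value_mem_of_forall_uIcc Set.ordConnected_univ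
      (fun x _ y _ => hT.convexValuesIn_uIcc hX x y) Set.univ_nonempty

theorem subalgebraGenerated_eq_sInter [Finite S] (A : Set S) :
    M.subalgebraGenerated A = ⋂₀ {T : Set S | A ⊆ T ∧ M.LLClosed T} := by
  refine Set.Subset.antisymm ?_ (Set.sInter_subset_of_mem
    ⟨M.subset_subalgebraGenerated A, M.llClosed_subalgebraGenerated A⟩)
  rintro _ ⟨w, rfl⟩ T ⟨hAT, hT⟩
  induction w using Quotient.inductionOn with
  | h X => exact hT.mul_mk_mem (X.map Subtype.val) fun x => hAT (X.label x).2

variable {M} in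
-- The projections carry each operation of the direct product to that of the factors; a set of
-- diagonal pairs has the same image under both, so its shuffle projects to one and the same
-- shuffle.
theorem llClosed_diagonal {M' : CircSemigroup emptyAllowed S}
    (hprod : ∀ a b, M.prod a b = M'.prod a b) (homega : ∀ a, M.omegaPow a = M'.omegaPow a)
    (hstar : ∀ a, M.omegaStarPow a = M'.omegaStarPow a)
    (hshuffle : ∀ (A : Set S) (hf : A.Finite) (hA : emptyAllowed ∨ A.Nonempty),
      M.shufflePow A hf hA = M'.shufflePow A hf hA) :
    (M.directProduct M').LLClosed (Set.diagonal S) := by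
  refine ⟨?_, ?_, ?_, fun C hf hC hCd => ?_⟩
  · rintro ⟨a, a'⟩ ha ⟨b, b'⟩ hb
    obtain rfl : a = a' := ha
    obtain rfl : b = b' := hb
    change M.mul ((pair _ _ _).map Prod.fst) = M'.mul ((pair _ _ _).map Prod.snd)
    rw [map_pair, map_pair]
    exact hprod a b
  · rintro ⟨a, a'⟩ ha
    obtain rfl : a = a' := ha
    exact homega a
  · rintro ⟨a, a'⟩ ha
    obtain rfl : a = a' := ha
    exact hstar a
  · change M.mul ((shuffle _ _ _).map Prod.fst) = M'.mul ((shuffle _ _ _).map Prod.snd)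
    have hC' : Prod.snd '' C = Prod.fst '' C := Set.image_congr fun p hp => (hCd hp).symm
    rw [map_shuffle, map_shuffle]
    simp only [hC']
    exact hshuffle _ (hf.image _) _

variable {M} in
theorem mul_eq_of_operations_eq [Finite S] {M' : CircSemigroup emptyAllowed S}
    (hprod : ∀ a b, M.prod a b = M'.prod a b) (homega : ∀ a, M.omegaPow a = M'.omegaPow a)
    (hstar : ∀ a, M.omegaStarPow a = M'.omegaStarPow a)
    (hshuffle : ∀ (A : Set S) (hf : A.Finite) (hA : emptyAllowed ∨ A.Nonempty),
      M.shufflePow A hf hA = M'.shufflePow A hf hA) :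
    M.mul = M'.mul := by
  funext w
  induction w using Quotient.inductionOn with
  | h X =>
    -- Both projections of the doubled word return the original word, so being on the diagonal is
    -- the desired equality.
    exact (llClosed_diagonal hprod homega hstar hshuffle).mul_mk_mem
      (X.map fun s => (s, s)) fun _ => rfl

end CircSemigroup

theorem mainTheorem6 (emptyAllowed : Prop) {S : Type*} [Finite S] :
    -- the multiplication is determined by the four operations
    (∀ M₁ M₂ : CircSemigroup emptyAllowed S,
      (∀ a b, M₁.prod a b = M₂.prod a b) →
      (∀ a, M₁.omegaPow a = M₂.omegaPow a) →
      (∀ a, M₁.omegaStarPow a = M₂.omegaStarPow a) →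
      (∀ (A : Set S) (hf : A.Finite) (hA : emptyAllowed ∨ A.Nonempty),
        M₁.shufflePow A hf hA = M₂.shufflePow A hf hA) →
      M₁.mul = M₂.mul) ∧
    -- the four operations generate every sub-algebra
    (∀ (M : CircSemigroup emptyAllowed S) (A : Set S),
      M.subalgebraGenerated A = ⋂₀ {T : Set S | A ⊆ T ∧ M.LLClosed T}) :=
  ⟨fun _ _ h1 h2 h3 h4 => CircSemigroup.mul_eq_of_operations_eq h1 h2 h3 h4,
    fun M A => M.subalgebraGenerated_eq_sInter A⟩
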